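/- Let $(\mathcal A,\tau)$ denote a unital $C^*$-algebra with a faithful state. A (standard) semicircle variable is a self-adjoint $s\in\mathcal A$ with $\tau(s^n)=\frac1{2\pi}\int_{-2}^{2}x^n\sqrt{4-x^2}\,dx$ for all $n\ge 0$. For a simple graph $G$ on $[L]=\{1,\dots,L\}$, unital subalgebras $\mathcal A_1,\dots,\mathcal A_L\subset\mathcal A$ are $G$-independent if (i) for every edge $(i,j)$ of $G$, $\mathcal A_i$ and $\mathcal A_j$ are classically independent, i.e. they commute and $\tau(ab)=0$ whenever $a\in\mathcal A_i$, $b\in\mathcal A_j$ and $\tau(a)=\tau(b)=0$; (ii) for every $k\ge1$ and $i\in[L]^k$ such that whenever $j_1<j_2$ and $i_{j_1}=i_{j_2}$ there is $j_1<j_3<j_2$ with $(i_{j_1},i_{j_3})\notin E(G)$, one has $\tau(a_1\cdots a_k)=0$ for all $a_j\in\mathcal A_{i_j}$ with $\tau(a_j)=0$, $j=1,\dots,k$. Semicircle variables $s_1,\dots,s_L$ are $G$-independent if the unital subalgebras they generate are; in that case write $T_G=L^{-1/2}\sum_{i=1}^L s_i$. Let $L\ge1$ and let $\omega$ be an integer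 dividing $L$. Let $K$ be the Turán graph on $L$ vertices, i.e. the complete $\omega$-partite graph with parts of equal size $L/\omega$. Then for every graph $G$ on $L$ vertices with clique number $\omega$, and for all families of $G$-independent and of $K$-independent semicircle variables (in possibly different spaces $(\mathcal A,\tau)$), $$\|T_G\|\le\|T_K\| .$$ Moreover, $\|T_K\|=2\sqrt{\omega}$. -/

import Mathlib

namespace GraphIndependence

open scoped ComplexOrder in
/-- `(A, τ)` is a C*-probability space with faithful `τ`: the linear functional `τ` on the unital
C*-algebra `A` is a faithful state. -/
structure IsFaithfulState {A : Type*} [CStarAlgebra A] (τ : A →ₗ[ℂ] ℂ) : Prop where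
  map_one : τ 1 = 1
  nonneg : ∀ a : A, 0 ≤ τ (star a * a)
  faithful : ∀ a : A, τ (star a * a) = 0 → a = 0

/-- Classical independence of two unital subalgebras: they commute, and products of centered
elements are centered. -/
def ClassicallyIndependent {A : Type*} [CStarAlgebra A] (τ : A →ₗ[ℂ] ℂ)
    (B C : Subalgebra ℂ A) : Prop :=
  (∀ b ∈ B, ∀ c ∈ C, b * c = c * b) ∧
    ∀ b ∈ B, ∀ c ∈ C, τ b = 0 → τ c = 0 → τ (b * c) = 0

/-- A word `i` in the vertices of `G` is reduced if between any two occurrences of a letter there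
is a letter which is not adjacent to it. -/
def IsReducedWord {V : Type*} (G : SimpleGraph V) {k : ℕ} (i : Fin k → V) : Prop :=
  ∀ j₁ j₂ : Fin k, j₁ < j₂ → i j₁ = i j₂ →
    ∃ j₃ : Fin k, j₁ < j₃ ∧ j₃ < j₂ ∧ ¬ G.Adj (i j₁) (i j₃)

/-- `G`-independence of a family of unital subalgebras indexed by the vertices of `G`: adjacent
vertices carry classically independent subalgebras, and a product of centered elements along a
nonempty reduced word is centered. -/
structure GIndependent {V : Type*} (G : SimpleGraph V) {A : Type*} [CStarAlgebra A]
    (τ : A →ₗ[ℂ] ℂ) (𝒜 : V → Subalgebra ℂ A) : Prop where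
  classical : ∀ i j : V, G.Adj i j → ClassicallyIndependent τ (𝒜 i) (𝒜 j)
  reduced : ∀ k : ℕ, 1 ≤ k → ∀ i : Fin k → V, IsReducedWord G i →
    ∀ a : Fin k → A, (∀ j, a j ∈ 𝒜 (i j)) → (∀ j, τ (a j) = 0) → τ (List.ofFn a).prod = 0

/-- A (standard) semicircle variable: a self-adjoint element whose moments are those of the
semicircle law with density `√(4 - x²) / (2π)` on `[-2, 2]`. -/
structure IsSemicircle {A : Type*} [CStarAlgebra A] (τ : A →ₗ[ℂ] ℂ) (s : A) : Prop where
  selfAdjoint : IsSelfAdjoint s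
  moments : ∀ n : ℕ,
    τ (s ^ n) = ((∫ x in (-2 : ℝ)..2, x ^ n * (√(4 - x ^ 2) / (2 * Real.pi)) : ℝ) : ℂ)

/-- `s` is a family of `G`-independent semicircle variables: each `s i` is a semicircle variable,
and the unital subalgebras generated by the `s i` are `G`-independent. (As `s i` is self-adjoint,
the subalgebra it generates is closed under the star operation.) -/
structure IsGIndependentSemicircles {V : Type*} (G : SimpleGraph V) {A : Type*} [CStarAlgebra A]
    (τ : A →ₗ[ℂ] ℂ) (s : V → A) : Prop where
  semicircle : ∀ i, IsSemicircle τ (s i)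
  independent : GIndependent G τ fun i => Algebra.adjoin ℂ {s i}

/-- The normalized sum `L^{-1/2} (s₁ + ⋯ + s_L)`. -/
noncomputable def normalizedSum {A : Type*} [CStarAlgebra A] {L : ℕ} (s : Fin L → A) : A :=
  (((√(L : ℝ))⁻¹ : ℝ) : ℂ) • ∑ i, s i

end GraphIndependence

/-! Products of Chebyshev polynomials `S` of the `s i` along reduced words behave like an orthogonal
basis: `τ` kills all but the empty one, and multiplying by `s i` creates a letter `i` or cancels one
(`mul_blockWord`). Upper bound: let `X = ∑ s i`. Each of the `L` letters can be created, but the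
letters that can be cancelled on the left of a given word form a clique, so there are at most `ω` of
them. Weighting a word of size `k` by `r ^ k` bounds the moments of `X` by powers of `L r + ω / r`,
which is `2√(Lω)` at `r = √(ω/L)`; faithfulness of `τ` turns moment bounds into a norm bound. Lower
bound for `K`: each normalized class sum satisfies the same Chebyshev recursion as one semicircle,
and the `ω` class sums commute. A product `z` of sine-weighted Chebyshev sums, one per class, is an
approximate eigenvector of their sum `Y`: `Y z - 2ω cos θ • z` is a nonnegative combination of
words. Since `τ ≥ 0` on such combinations and `Y` preserves them, `‖Y‖ ≥ 2ω cos θ`; then `θ → 0`. -/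

namespace GraphIndependence

/-! ### Combinatorics of reduced words in a graph. -/

section Blocks

variable {V : Type*} (G : SimpleGraph V)

open Classical in
/-- Multiply a block word by the letter `i` on the left: a pair `(j, n)` stands for `j ^ (n + 1)`,
and `i` moves to the right past the letters adjacent to it until it meets a block of its own
or is stopped. -/
noncomputable def push (i : V) : List (V × ℕ) → List (V × ℕ)
  | [] => [(i, 0)]
  | (j, n) :: B =>
    if i = j then (j, n + 1) :: B
    else if G.Adj i j then (j, n) :: push i B else (i, 0) :: (j, n) :: B

open Classical in
/-- Cancel the letter `i` on the left of a block word, if possible. -/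
noncomputable def pop (i : V) : List (V × ℕ) → Option (List (V × ℕ))
  | [] => none
  | (j, n) :: B =>
    if i = j then some (match n with
      | 0 => B
      | n + 1 => (j, n) :: B)
    else if G.Adj i j then (pop i B).map ((j, n) :: ·) else none

/-- The letter `i` cannot be moved to the right into a block of its own. -/
def Blocked (i : V) : List (V × ℕ) → Prop
  | [] => True
  | (j, _) :: B => j ≠ i ∧ (G.Adj i j → Blocked i B)

/-- The letters of the blocks form a reduced word. -/
def ReducedBlocks : List (V × ℕ) → Prop
  | [] => True
  | (j, _) :: B => Blocked G j B ∧ ReducedBlocks B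

/-- The number of letters of a block word, with multiplicities. -/
def blockSize : List (V × ℕ) → ℕ
  | [] => 0
  | (_, n) :: B => n + 1 + blockSize B

variable {G}

theorem blocked_push {i j : V} (h : G.Adj j i) {B : List (V × ℕ)} (hB : Blocked G j B) :
    Blocked G j (push G i B) := by
  induction B with
  | nil => exact ⟨h.ne', fun _ => trivial⟩
  | cons p B ih =>
    obtain ⟨k, n⟩ := p
    obtain ⟨h1, h2⟩ := hB
    unfold push
    split_ifs with hk hik
    · exact ⟨h1, h2⟩
    · exact ⟨h1, fun h' => ih (h2 h')⟩
    · exact ⟨h.ne', fun _ => ⟨h1, h2⟩⟩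

theorem reducedBlocks_push (i : V) {B : List (V × ℕ)} (hB : ReducedBlocks G B) :
    ReducedBlocks G (push G i B) := by
  induction B with
  | nil => exact ⟨trivial, trivial⟩
  | cons p B ih =>
    obtain ⟨k, n⟩ := p
    obtain ⟨h1, h2⟩ := hB
    unfold push
    split_ifs with hk hik
    · exact ⟨h1, h2⟩
    · exact ⟨blocked_push hik.symm h1, ih h2⟩
    · exact ⟨⟨fun h => hk h.symm, fun h => absurd h hik⟩, h1, h2⟩

theorem blocked_pop {i j : V} (h : G.Adj j i) {B B' : List (V × ℕ)} (hB : Blocked G j B)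
    (hp : pop G i B = some B') : Blocked G j B' := by
  induction B generalizing B' with
  | nil => simp [pop] at hp
  | cons p B ih =>
    obtain ⟨k, n⟩ := p
    obtain ⟨h1, h2⟩ := hB
    unfold pop at hp
    split_ifs at hp with hk hik
    · subst hk
      cases n with
      | zero => obtain rfl := Option.some.inj hp; exact h2 h
      | succ n => obtain rfl := Option.some.inj hp; exact ⟨h1, h2⟩
    · obtain ⟨C, hC, rfl⟩ := Option.map_eq_some_iff.1 hp
      exact ⟨h1, fun h' => ih (h2 h') hC⟩

theorem reducedBlocks_pop {i : V} {B B' : List (V × ℕ)} (hB : ReducedBlocks G B)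
    (hp : pop G i B = some B') : ReducedBlocks G B' := by
  induction B generalizing B' with
  | nil => simp [pop] at hp
  | cons p B ih =>
    obtain ⟨k, n⟩ := p
    obtain ⟨h1, h2⟩ := hB
    unfold pop at hp
    split_ifs at hp with hk hik
    · cases n with
      | zero => obtain rfl := Option.some.inj hp; exact h2
      | succ n => obtain rfl := Option.some.inj hp; exact ⟨h1, h2⟩
    · obtain ⟨C, hC, rfl⟩ := Option.map_eq_some_iff.1 hp
      exact ⟨blocked_pop hik.symm h1 hC, ih h2 hC⟩

theorem blockSize_push (i : V) (B : List (V × ℕ)) :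
    blockSize (push G i B) = blockSize B + 1 := by
  induction B with
  | nil => rfl
  | cons p B ih =>
    obtain ⟨k, n⟩ := p
    unfold push
    split_ifs <;> simp only [blockSize, ih] <;> omega

theorem blockSize_pop {i : V} {B B' : List (V × ℕ)} (hp : pop G i B = some B') :
    blockSize B = blockSize B' + 1 := by
  induction B generalizing B' with
  | nil => simp [pop] at hp
  | cons p B ih =>
    obtain ⟨k, n⟩ := p
    unfold pop at hp
    split_ifs at hp with hk hik
    · cases n with
      | zero => obtain rfl := Option.some.inj hp; simp only [blockSize]; omega
      | succ n => obtain rfl := Option.some.inj hp; simp only [blockSize]; omega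
    · obtain ⟨C, hC, rfl⟩ := Option.map_eq_some_iff.1 hp
      simp only [blockSize, ih hC]; omega

theorem pop_push_self (i : V) (B : List (V × ℕ)) : pop G i (push G i B) = some B := by
  induction B with
  | nil => simp [push, pop]
  | cons p B ih =>
    obtain ⟨k, n⟩ := p
    unfold push
    split_ifs with hk hik <;> simp [pop, *]

/-- The new `j` only moved past letters adjacent to `j`, none of which is `i`; so `i` is stopped at
the block of `j` or earlier. -/
theorem pop_push_of_not_adj {i j : V} (hne : i ≠ j) (hij : ¬ G.Adj i j) (B : List (V × ℕ)) :
    pop G i (push G j B) = none := by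
  induction B with
  | nil => simp [push, pop, hne, hij]
  | cons p B ih =>
    obtain ⟨k, n⟩ := p
    unfold push
    split_ifs with hk hik
    · subst hk; simp [pop, hne, hij]
    · have : i ≠ k := by rintro rfl; exact hij hik.symm
      simp [pop, this, ih]
    · simp [pop, hne, hij]

theorem pop_eq_none_of_forall_ne {i : V} {B : List (V × ℕ)} (h : ∀ p ∈ B, p.1 ≠ i) :
    pop G i B = none := by
  induction B with
  | nil => rfl
  | cons p B ih =>
    obtain ⟨k, n⟩ := p
    have h1 : i ≠ k := fun e => h (k, n) (by simp) e.symm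
    simp [pop, h1, ih fun p hp => h p (List.mem_cons_of_mem _ hp)]

/-- Whichever of the two blocks to be cancelled comes first, the other letter has to cross it. This
is how the clique number enters. -/
theorem adj_of_pop_ne_none {i j : V} {B : List (V × ℕ)} (hi : pop G i B ≠ none)
    (hj : pop G j B ≠ none) (hne : i ≠ j) : G.Adj i j := by
  induction B with
  | nil => simp [pop] at hi
  | cons p B ih =>
    obtain ⟨k, n⟩ := p
    unfold pop at hi hj
    split_ifs at hi hj with h1 h2 h3 h4 h5 h6
    · exact absurd (h1.trans h2.symm) hne
    · subst h1; exact h3.symm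
    · exact absurd rfl hj
    · subst h5; exact h4
    · exact ih (by simpa using hi) (by simpa using hj)
    · exact absurd rfl hj
    all_goals exact absurd rfl hi

theorem forall_mem_push {P : V → Prop} {i : V} (hi : P i) {B : List (V × ℕ)}
    (hB : ∀ p ∈ B, P p.1) : ∀ p ∈ push G i B, P p.1 := by
  induction B with
  | nil => simpa [push] using hi
  | cons p B ih =>
    obtain ⟨k, n⟩ := p
    rw [List.forall_mem_cons] at hB
    unfold push
    split_ifs
    · exact List.forall_mem_cons.2 hB
    · exact List.forall_mem_cons.2 ⟨hB.1, ih hB.2⟩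
    · exact List.forall_mem_cons.2 ⟨hi, List.forall_mem_cons.2 hB⟩

theorem forall_mem_pop {P : V → Prop} {i : V} {B B' : List (V × ℕ)}
    (hB : ∀ p ∈ B, P p.1) (hp : pop G i B = some B') : ∀ p ∈ B', P p.1 := by
  induction B generalizing B' with
  | nil => simp [pop] at hp
  | cons p B ih =>
    obtain ⟨k, n⟩ := p
    simp only [List.forall_mem_cons] at hB
    unfold pop at hp
    split_ifs at hp with hk hik
    · cases n with
      | zero => obtain rfl := Option.some.inj hp; exact hB.2
      | succ n => obtain rfl := Option.some.inj hp; simpa using hB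
    · obtain ⟨C, hC, rfl⟩ := Option.map_eq_some_iff.1 hp
      simpa using ⟨hB.1, fun a b h => ih hB.2 hC (a, b) h⟩

theorem Blocked.exists_not_adj {i : V} {B : List (V × ℕ)} (h : Blocked G i B) {m : ℕ}
    (hm : m < B.length) (e : B[m].1 = i) :
    ∃ (l : ℕ) (hl : l < m), ¬ G.Adj i (B[l]'(hl.trans hm)).1 := by
  induction B generalizing m with
  | nil => simp at hm
  | cons p B ih =>
    obtain ⟨k, n⟩ := p
    obtain ⟨h1, h2⟩ := h
    cases m with
    | zero => exact absurd e h1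
    | succ m =>
      by_cases ha : G.Adj i k
      · obtain ⟨l, hl, hh⟩ := ih (h2 ha) (m := m) (by simpa using hm) (by simpa using e)
        exact ⟨l + 1, by omega, by simpa using hh⟩
      · exact ⟨0, by omega, by simpa using ha⟩

theorem ReducedBlocks.isReducedWord {B : List (V × ℕ)} (h : ReducedBlocks G B) :
    IsReducedWord G fun j : Fin B.length => (B.get j).1 := by
  suffices ∀ (a b : ℕ) (hab : a < b) (hb : b < B.length), (B[a]'(hab.trans hb)).1 = B[b].1 →
      ∃ (c : ℕ) (_ : a < c) (hc : c < b),
        ¬ G.Adj (B[a]'(hab.trans hb)).1 (B[c]'(hc.trans hb)).1 by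
    intro a b hab e
    obtain ⟨c, h1, h2, h3⟩ := this a b hab b.2 e
    exact ⟨⟨c, h2.trans b.2⟩, h1, h2, h3⟩
  induction B with
  | nil => intro a b _ hb; simp at hb
  | cons p B ih =>
    obtain ⟨k, n⟩ := p
    obtain ⟨h1, h2⟩ := h
    intro a b hab hb e
    obtain ⟨b, rfl⟩ : ∃ b', b = b' + 1 := ⟨b - 1, by omega⟩
    cases a with
    | zero =>
      obtain ⟨l, hl, hh⟩ := h1.exists_not_adj (m := b) (by simpa using hb) (by simpa using e.symm)
      exact ⟨l + 1, by omega, by omega, by simpa using hh⟩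
    | succ a =>
      obtain ⟨c, h3, h4, h5⟩ := ih h2 a b (by omega) (by simpa using hb) (by simpa using e)
      exact ⟨c + 1, by omega, by omega, by simpa using h5⟩

end Blocks

end GraphIndependence

/-! ### Chebyshev words and their trace. -/

namespace GraphIndependence

section Words

open Polynomial

variable {V : Type*} {G : SimpleGraph V}

/-- The element of the algebra given by a block word: the block `(i, n)` stands for the Chebyshev
polynomial of degree `n + 1` evaluated at `s i`. -/
noncomputable def blockWord {A : Type*} [Ring A] [Algebra ℂ A] (s : V → A) :
    List (V × ℕ) → A
  | [] => 1
  | (i, n) :: B => aeval (s i) (Chebyshev.S ℂ ((n + 1 : ℕ) : ℤ)) * blockWord s B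

theorem aeval_S_add_two {A : Type*} [Ring A] [Algebra ℂ A] (x : A) (n : ℕ) :
    aeval x (Chebyshev.S ℂ ((n + 2 : ℕ) : ℤ)) =
      x * aeval x (Chebyshev.S ℂ ((n + 1 : ℕ) : ℤ)) - aeval x (Chebyshev.S ℂ (n : ℤ)) := by
  have := Chebyshev.S_add_two ℂ (n : ℤ)
  push_cast
  rw [this]
  simp

/-- The recurrence `x S_{n+1} = S_{n+2} + S_n` at the block that `i` reaches; when that block is a
single letter, `S_0 = 1` and the block disappears. -/
theorem mul_blockWord {A : Type*} [Ring A] [Algebra ℂ A] {s : V → A}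
    (hs : ∀ i j, G.Adj i j → Commute (s i) (s j)) (i : V) (B : List (V × ℕ)) :
    s i * blockWord s B =
      blockWord s (push G i B) + (pop G i B).elim 0 (blockWord s) := by
  induction B with
  | nil => simp [push, pop, blockWord]
  | cons p B ih =>
    obtain ⟨k, n⟩ := p
    unfold push pop
    split_ifs with hk hik
    · subst hk
      have h := aeval_S_add_two (s i) n
      cases n with
      | zero =>
        simp only [blockWord, Option.elim_some]
        rw [h]
        simp [sub_mul, mul_assoc]
      | succ n =>
        simp only [blockWord, Option.elim_some]
        rw [h]
        simp [sub_mul, mul_assoc]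
    · have hc : Commute (s i) (aeval (s k) (Chebyshev.S ℂ ((n + 1 : ℕ) : ℤ))) :=
        Algebra.commute_of_mem_adjoin_singleton_of_commute
          (aeval_mem_adjoin_singleton _ _) (hs i k hik)
      simp only [blockWord]
      rw [← mul_assoc, hc.eq, mul_assoc, ih, mul_add]
      cases pop G i B <;> simp [blockWord]
    · simp [blockWord]

variable {A : Type*} [CStarAlgebra A] {τ : A →ₗ[ℂ] ℂ} {s : V → A}

theorem IsSemicircle.map_aeval {x : A} (hx : IsSemicircle τ x) (p : ℝ[X]) :
    τ (aeval x (p.map (algebraMap ℝ ℂ))) =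
      ((∫ t in (-2 : ℝ)..2, p.eval t * (√(4 - t ^ 2) / (2 * Real.pi)) : ℝ) : ℂ) := by
  have hi : ∀ q : ℝ[X], IntervalIntegrable
      (fun t => q.eval t * (√(4 - t ^ 2) / (2 * Real.pi))) MeasureTheory.volume (-2) 2 :=
    fun q => Continuous.intervalIntegrable (by fun_prop) _ _
  induction p using Polynomial.induction_on' with
  | add p q hp hq =>
    simp only [Polynomial.map_add, map_add, eval_add, add_mul, hp, hq]
    rw [intervalIntegral.integral_add (hi p) (hi q)]
    push_cast
    rfl
  | monomial n c =>
    simp only [map_monomial, aeval_monomial, eval_monomial, mul_assoc]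
    rw [intervalIntegral.integral_const_mul, ← Algebra.smul_def, map_smul, hx.moments n]
    simp

/-- With `t = 2 cos θ` one has `S_{n+1}(t) sin θ = sin ((n+2)θ)`, so the integrand becomes a
difference of cosines of frequencies `n + 1` and `n + 3`, both nonzero. -/
theorem integral_eval_S_mul_sqrt (n : ℕ) :
    ∫ t in (-2 : ℝ)..2, (Chebyshev.S ℝ ((n + 1 : ℕ) : ℤ)).eval t * (√(4 - t ^ 2) / (2 * Real.pi))
      = 0 := by
  have hsub := intervalIntegral.integral_comp_mul_deriv (a := Real.pi) (b := 0)
    (f := fun θ => 2 * Real.cos θ) (f' := fun θ => -(2 * Real.sin θ))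
    (g := fun t => (Chebyshev.S ℝ ((n + 1 : ℕ) : ℤ)).eval t * (√(4 - t ^ 2) / (2 * Real.pi)))
    (fun θ _ => by simpa using (Real.hasDerivAt_cos θ).const_mul 2) (by fun_prop) (by fun_prop)
  simp only [Real.cos_pi, Real.cos_zero, mul_neg, mul_one] at hsub
  rw [← hsub, intervalIntegral.integral_symm, neg_eq_zero]
  have hpt : ∀ θ ∈ Set.uIcc 0 Real.pi,
      -(((fun t => (Chebyshev.S ℝ ((n + 1 : ℕ) : ℤ)).eval t * (√(4 - t ^ 2) / (2 * Real.pi))) ∘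
        fun θ => 2 * Real.cos θ) θ * (2 * Real.sin θ)) =
      (Real.pi)⁻¹ * (Real.cos ((n + 3 : ℕ) * θ) - Real.cos ((n + 1 : ℕ) * θ)) := by
    intro θ hθ
    rw [Set.uIcc_of_le Real.pi_pos.le] at hθ
    have hsin : 0 ≤ Real.sin θ := Real.sin_nonneg_of_mem_Icc hθ
    have hsqrt : √(4 - (2 * Real.cos θ) ^ 2) = 2 * Real.sin θ := by
      rw [show 4 - (2 * Real.cos θ) ^ 2 = (2 * Real.sin θ) ^ 2 by
        nlinarith [Real.sin_sq_add_cos_sq θ], Real.sqrt_sq (by positivity)]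
    have hS := Chebyshev.S_two_mul_real_cos θ ((n + 1 : ℕ) : ℤ)
    have h1 : ((n + 3 : ℕ) : ℝ) * θ = (n + 2 : ℝ) * θ + θ := by push_cast; ring
    have h2 : ((n + 1 : ℕ) : ℝ) * θ = (n + 2 : ℝ) * θ - θ := by push_cast; ring
    have h3 : ((((n + 1 : ℕ) : ℤ) : ℝ) + 1) * θ = (n + 2 : ℝ) * θ := by push_cast; ring
    rw [h3] at hS
    rw [h1, h2, Real.cos_add, Real.cos_sub, ← hS]
    simp only [Function.comp_apply, hsqrt]
    field_simp
    ring
  have hcos : ∀ k : ℕ, k ≠ 0 → ∫ θ in (0 : ℝ)..Real.pi, Real.cos (k * θ) = 0 := by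
    intro k hk
    rw [intervalIntegral.integral_comp_mul_left (f := Real.cos) (by exact_mod_cast hk)]
    simp [Real.sin_nat_mul_pi]
  rw [intervalIntegral.integral_congr hpt, intervalIntegral.integral_const_mul,
    intervalIntegral.integral_sub
      (Continuous.intervalIntegrable (by fun_prop) _ _)
      (Continuous.intervalIntegrable (by fun_prop) _ _),
    hcos _ (by omega), hcos _ (by omega)]
  simp

theorem IsSemicircle.map_aeval_S {x : A} (hx : IsSemicircle τ x) (n : ℕ) :
    τ (aeval x (Chebyshev.S ℂ ((n + 1 : ℕ) : ℤ))) = 0 := by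
  rw [← Chebyshev.map_S (algebraMap ℝ ℂ), hx.map_aeval, integral_eval_S_mul_sqrt]
  simp

theorem blockWord_eq_prod (B : List (V × ℕ)) :
    blockWord s B = (List.ofFn fun j : Fin B.length =>
      aeval (s (B.get j).1) (Chebyshev.S ℂ (((B.get j).2 + 1 : ℕ) : ℤ))).prod := by
  induction B with
  | nil => simp [blockWord]
  | cons p B ih => simp [blockWord, ih, List.ofFn_succ]

/-- Blocks are indexed so that degrees are at least 1, which makes every factor centered. -/
theorem IsGIndependentSemicircles.map_blockWord (h : IsGIndependentSemicircles G τ s)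
    {B : List (V × ℕ)} (hB : ReducedBlocks G B) (hne : B ≠ []) : τ (blockWord s B) = 0 := by
  rw [blockWord_eq_prod]
  exact h.independent.reduced _ (List.length_pos_of_ne_nil hne) _ hB.isReducedWord _
    (fun j => aeval_mem_adjoin_singleton _ _) fun j => (h.semicircle _).map_aeval_S _

theorem IsGIndependentSemicircles.commute (h : IsGIndependentSemicircles G τ s) {i j : V}
    (hij : G.Adj i j) : Commute (s i) (s j) :=
  (h.independent.classical i j hij).1 _ (Algebra.self_mem_adjoin_singleton _ _) _
    (Algebra.self_mem_adjoin_singleton _ _)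

end Words

end GraphIndependence

/-! ### Norms and faithful states. -/

namespace GraphIndependence

section Norm

variable {A : Type*} [CStarAlgebra A] {τ : A →ₗ[ℂ] ℂ}

open scoped ComplexOrder in
-- Self-adjointness of `a` is not needed: otherwise `cfc` takes the default value 0.
theorem IsFaithfulState.map_cfc_nonneg (hτ : IsFaithfulState τ) {a : A}
    {f : ℝ → ℝ} (hf : Continuous f) (h0 : ∀ x ∈ spectrum ℝ a, 0 ≤ f x) :
    0 ≤ τ (cfc f a) := by
  have h1 : IsSelfAdjoint (cfc (fun x => √(f x)) a) := cfc_predicate _ a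
  have h2 : star (cfc (fun x => √(f x)) a) * cfc (fun x => √(f x)) a = cfc f a := by
    rw [h1.star_eq, ← cfc_mul (fun x => √(f x)) (fun x => √(f x)) a
      (by fun_prop) (by fun_prop)]
    exact cfc_congr fun x hx => Real.mul_self_sqrt (h0 x hx)
  rw [← h2]
  exact hτ.nonneg _

/-- For `D > C` let `g x = (x² - D²)₊`. On the spectrum `D^{2n} g ≤ ‖a‖² x^{2n}`, so `τ (g(a)) ≤
‖a‖² (C/D)^{2n} → 0`. By faithfulness `g(a) = 0`, and the spectrum lies in `[-D, D]`. -/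
theorem IsFaithfulState.norm_le_of_moments (hτ : IsFaithfulState τ) {a : A}
    (ha : IsSelfAdjoint a) {C : ℝ} (hC : 0 ≤ C) (h : ∀ n : ℕ, ‖τ (a ^ n)‖ ≤ C ^ n) :
    ‖a‖ ≤ C := by
  refine le_of_forall_gt_imp_ge_of_dense fun D hD => ?_
  have hD0 : 0 < D := hC.trans_lt hD
  set g : ℝ → ℝ := fun x => max (x ^ 2 - D ^ 2) 0 with hg
  have hgc : Continuous g := by fun_prop
  have hspec : ∀ x ∈ spectrum ℝ a, |x| ≤ ‖a‖ := by
    have h1 := (norm_cfc_le_iff (id : ℝ → ℝ) a (norm_nonneg a)).1 (by rw [cfc_id ℝ a])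
    simpa using h1
  have hg0 : ∀ x, 0 ≤ g x := fun x => le_max_right _ _
  set t : ℝ := (τ (cfc g a)).re with ht
  have hle : ∀ n : ℕ, D ^ (2 * n) * t ≤ ‖a‖ ^ 2 * C ^ (2 * n) := by
    intro n
    have hpos := hτ.map_cfc_nonneg (a := a)
      (f := fun x => ‖a‖ ^ 2 * x ^ (2 * n) - D ^ (2 * n) * g x) (by fun_prop) (by
        intro x hx
        rw [sub_nonneg, mul_comm]
        rcases le_total (x ^ 2) (D ^ 2) with hxD | hxD
        · have : g x = 0 := max_eq_right (by linarith)
          rw [this, zero_mul, pow_mul]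
          positivity
        · refine mul_le_mul (max_le ?_ (by positivity)) ?_ (by positivity) (by positivity)
          · have := sq_le_sq' (neg_le_of_abs_le (hspec x hx)) (le_of_abs_le (hspec x hx))
            nlinarith [sq_nonneg D]
          · rw [pow_mul, pow_mul]
            gcongr)
    rw [cfc_sub (fun x : ℝ => ‖a‖ ^ 2 * x ^ (2 * n)) (fun x => D ^ (2 * n) * g x) a
        (by fun_prop) (by fun_prop),
      cfc_const_mul (‖a‖ ^ 2) (fun x : ℝ => x ^ (2 * n)) a (by fun_prop),
      cfc_const_mul (D ^ (2 * n)) g a (by fun_prop), cfc_pow_id a (2 * n),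
      ← Complex.coe_smul, ← Complex.coe_smul, map_sub, map_smul, map_smul] at hpos
    have hre := (Complex.le_def.1 hpos).1
    simp only [Complex.sub_re, smul_eq_mul, Complex.re_ofReal_mul, Complex.zero_re] at hre
    have h1 := (Complex.re_le_norm _).trans (h (2 * n))
    nlinarith [mul_le_mul_of_nonneg_left h1 (sq_nonneg ‖a‖)]
  have ht0 : t ≤ 0 := by
    have hlim : Filter.Tendsto (fun n : ℕ => ‖a‖ ^ 2 * ((C / D) ^ 2) ^ n) Filter.atTop
        (nhds (‖a‖ ^ 2 * 0)) :=
      (tendsto_pow_atTop_nhds_zero_of_lt_one (by positivity)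
        (pow_lt_one₀ (by positivity) ((div_lt_one hD0).2 hD) two_ne_zero)).const_mul _
    rw [mul_zero] at hlim
    refine ge_of_tendsto' hlim fun n => ?_
    have h1 := hle n
    rw [← pow_mul, div_pow, ← mul_div_assoc, le_div_iff₀ (by positivity)]
    linarith
  have hk : IsSelfAdjoint (cfc (fun x => √(g x)) a) := cfc_predicate _ a
  have hk2 : star (cfc (fun x => √(g x)) a) * cfc (fun x => √(g x)) a = cfc g a := by
    rw [hk.star_eq, ← cfc_mul (fun x => √(g x)) (fun x => √(g x)) a (by fun_prop) (by fun_prop)]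
    exact cfc_congr fun x _ => Real.mul_self_sqrt (hg0 x)
  have hnn := Complex.le_def.1 (hτ.nonneg (cfc (fun x => √(g x)) a))
  rw [hk2] at hnn
  have hz : τ (cfc g a) = 0 :=
    Complex.ext (le_antisymm ht0 hnn.1) hnn.2.symm
  have hzero : cfc (fun x => √(g x)) a = 0 := hτ.faithful _ (by rw [hk2, hz])
  have hgz : cfc g a = 0 := by rw [← hk2, hzero, mul_zero]
  have hgx := (norm_cfc_le_iff g a le_rfl (by fun_prop)).1 (by rw [hgz, norm_zero])
  have h2 := (norm_cfc_le_iff (id : ℝ → ℝ) a hD0.le).2 (by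
    intro x hx
    have h3 : g x ≤ 0 := (le_abs_self _).trans (hgx x hx)
    have h4 : x ^ 2 - D ^ 2 ≤ 0 := (le_max_left _ _).trans h3
    simpa [abs_of_pos hD0] using sq_le_sq.1 (sub_nonpos.1 h4))
  rwa [cfc_id ℝ a] at h2

theorem IsFaithfulState.norm_apply_le_of_isSelfAdjoint (hτ : IsFaithfulState τ) {a : A}
    (ha : IsSelfAdjoint a) : ‖τ a‖ ≤ ‖a‖ := by
  have hspec : ∀ x ∈ spectrum ℝ a, |x| ≤ ‖a‖ := by
    have h1 := (norm_cfc_le_iff (id : ℝ → ℝ) a (norm_nonneg a)).1 (by rw [cfc_id ℝ a])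
    simpa using h1
  have h1 := hτ.map_cfc_nonneg (a := a) (f := fun x => ‖a‖ - x) (by fun_prop)
    fun x hx => sub_nonneg.2 (le_of_abs_le (hspec x hx))
  have h2 := hτ.map_cfc_nonneg (a := a) (f := fun x => ‖a‖ + x) (by fun_prop)
    fun x hx => by linarith [neg_le_of_abs_le (hspec x hx)]
  rw [cfc_sub (fun _ => ‖a‖) (fun x => x) a, cfc_const _ a, cfc_id' ℝ a,
    Algebra.algebraMap_eq_smul_one, ← Complex.coe_smul, map_sub, map_smul, hτ.map_one] at h1
  rw [cfc_add a (fun _ => ‖a‖) (fun x => x), cfc_const _ a, cfc_id' ℝ a,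
    Algebra.algebraMap_eq_smul_one, ← Complex.coe_smul, map_add, map_smul, hτ.map_one] at h2
  obtain ⟨h1, h1'⟩ := Complex.le_def.1 h1
  obtain ⟨h2, -⟩ := Complex.le_def.1 h2
  simp at h1 h1' h2
  have : τ a = ((τ a).re : ℂ) := Complex.ext rfl (by simp [← h1'])
  rw [this, Complex.norm_real]
  exact abs_le.2 ⟨by linarith, by linarith⟩

/-- The crude factor 2 is harmless, as the bound is applied to growth rates of powers. -/
theorem IsFaithfulState.norm_apply_le (hτ : IsFaithfulState τ) (a : A) : ‖τ a‖ ≤ 2 * ‖a‖ := by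
  have h : τ a = τ (realPart a : A) + Complex.I * τ (imaginaryPart a : A) := by
    rw [← smul_eq_mul, ← map_smul, ← map_add, realPart_add_I_smul_imaginaryPart]
  rw [h]
  have h1 := hτ.norm_apply_le_of_isSelfAdjoint (realPart a).2
  have h2 := hτ.norm_apply_le_of_isSelfAdjoint (imaginaryPart a).2
  have h3 : ‖(realPart a : A)‖ ≤ ‖a‖ := realPart.norm_le a
  have h4 : ‖(imaginaryPart a : A)‖ ≤ ‖a‖ := imaginaryPart.norm_le a
  calc _ ≤ ‖τ (realPart a : A)‖ + ‖Complex.I * τ (imaginaryPart a : A)‖ := norm_add_le _ _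
    _ ≤ _ := by
      rw [norm_mul, Complex.norm_I, one_mul]
      linarith

end Norm

end GraphIndependence

/-! ### Upper bound by the clique number. -/

namespace GraphIndependence

section UpperBound

variable {V : Type*} [Fintype V] {G : SimpleGraph V} {A : Type*} [CStarAlgebra A]
  {τ : A →ₗ[ℂ] ℂ} {s : V → A}

open Classical in
-- Only `B = []` is wanted; general words let the induction absorb one factor `∑ s i` at a time.
theorem IsGIndependentSemicircles.norm_map_pow_mul_blockWord_le
    (h : IsGIndependentSemicircles G τ s) (hone : τ 1 = 1) {a b : ℝ} (ha : 0 < a) (hb : 0 < b)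
    (hcard : (Fintype.card V : ℝ) = a ^ 2)
    (hclique : ∀ t : Finset V, G.IsClique t → (t.card : ℝ) ≤ b ^ 2) (n : ℕ)
    {B : List (V × ℕ)} (hB : ReducedBlocks G B) :
    ‖τ ((∑ i, s i) ^ n * blockWord s B)‖ ≤ (2 * (a * b)) ^ n * (b / a) ^ blockSize B := by
  induction n generalizing B with
  | zero =>
    by_cases hne : B = []
    · subst hne
      simp [blockWord, hone, blockSize]
    · simp only [pow_zero, one_mul]
      rw [h.map_blockWord hB hne, norm_zero]
      positivity
  | succ n ih =>
    set X := ∑ i, s i with hX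
    set C := 2 * (a * b) with hC
    set r := b / a with hr
    set k := blockSize B with hk
    have hr0 : 0 < r := by positivity
    have hC0 : 0 < C := by positivity
    set t : Finset V := Finset.univ.filter fun i => pop G i B ≠ none with ht
    have htc : (t.card : ℝ) ≤ b ^ 2 := by
      refine hclique t fun i hi j hj hij => adj_of_pop_ne_none (B := B) ?_ ?_ hij
      · simpa [ht] using hi
      · simpa [ht] using hj
    have hpush : ∀ i, ‖τ (X ^ n * blockWord s (push G i B))‖ ≤ C ^ n * r ^ (k + 1) := by
      intro i
      have := ih (reducedBlocks_push i hB)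
      rwa [blockSize_push] at this
    have hpop : ∀ i, ‖τ (X ^ n * (pop G i B).elim 0 (blockWord s))‖ ≤
        if i ∈ t then C ^ n * (r ^ k / r) else 0 := by
      intro i
      rcases hp : pop G i B with _ | B'
      · simp [ht, hp]
      · have := ih (reducedBlocks_pop hB hp)
        have hit : i ∈ t := by simp [ht, hp]
        rw [if_pos hit, hk, blockSize_pop hp, pow_succ, mul_div_cancel_right₀ _ hr0.ne']
        exact this
    have hsum : τ (X ^ (n + 1) * blockWord s B) =
        ∑ i, τ (X ^ n * blockWord s (push G i B)) +
          ∑ i, τ (X ^ n * (pop G i B).elim 0 (blockWord s)) := by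
      rw [pow_succ, mul_assoc, hX, Finset.sum_mul, Finset.mul_sum, map_sum,
        ← Finset.sum_add_distrib]
      refine Finset.sum_congr rfl fun i _ => ?_
      rw [mul_blockWord (fun _ _ => h.commute), mul_add, map_add]
    have h1 : ‖∑ i, τ (X ^ n * blockWord s (push G i B))‖ ≤ a ^ 2 * (C ^ n * r ^ (k + 1)) := by
      refine (norm_sum_le_of_le _ fun i _ => hpush i).trans ?_
      rw [Finset.sum_const, nsmul_eq_mul, Finset.card_univ, hcard]
    have h2 : ‖∑ i, τ (X ^ n * (pop G i B).elim 0 (blockWord s))‖ ≤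
        b ^ 2 * (C ^ n * (r ^ k / r)) := by
      refine (norm_sum_le_of_le _ fun i _ => hpop i).trans ?_
      rw [Finset.sum_ite_mem, Finset.univ_inter, Finset.sum_const, nsmul_eq_mul]
      gcongr
    rw [hsum]
    refine (norm_add_le _ _).trans ((add_le_add h1 h2).trans_eq ?_)
    -- The choice `r = b / a` minimizes the left side (AM-GM).
    have h3 : a ^ 2 * r + b ^ 2 / r = C := by
      rw [hr, hC]
      field_simp
      ring
    rw [pow_succ C, ← h3]
    ring

theorem IsGIndependentSemicircles.norm_sum_le (h : IsGIndependentSemicircles G τ s)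
    (hτ : IsFaithfulState τ) {a b : ℝ} (ha : 0 < a) (hb : 0 < b)
    (hcard : (Fintype.card V : ℝ) = a ^ 2)
    (hclique : ∀ t : Finset V, G.IsClique t → (t.card : ℝ) ≤ b ^ 2) :
    ‖∑ i, s i‖ ≤ 2 * (a * b) := by
  refine hτ.norm_le_of_moments
    (isSelfAdjoint_sum _ fun i _ => (h.semicircle i).selfAdjoint) (by positivity) fun n => ?_
  simpa [blockWord, blockSize] using
    h.norm_map_pow_mul_blockWord_le hτ.map_one ha hb hcard hclique n (B := []) trivial

end UpperBound

end GraphIndependence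

/-! ### Lower bound for complete multipartite graphs. -/

namespace GraphIndependence

section LowerBound

open Polynomial

section Cone

variable {V : Type*} (G : SimpleGraph V) {A : Type*} [Ring A] [Algebra ℂ A] (s : V → A)

/-- The sum of all words obtained by multiplying a block word on the left by `n` letters
from `c`. -/
noncomputable def pushSum (c : Finset V) : ℕ → List (V × ℕ) → A
  | 0, B => blockWord s B
  | n + 1, B => ∑ i ∈ c, pushSum c n (push G i B)

/-- The convex cone generated by the reduced words whose letters satisfy `P`. -/
def wordCone (P : V → Prop) : AddSubmonoid A :=
  AddSubmonoid.closure {z | ∃ (r : ℝ) (B : List (V × ℕ)), 0 ≤ r ∧ ReducedBlocks G B ∧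
    (∀ p ∈ B, P p.1) ∧ z = (r : ℂ) • blockWord s B}

variable {G s}

theorem blockWord_mem_wordCone {P : V → Prop} {B : List (V × ℕ)} (hB : ReducedBlocks G B)
    (hP : ∀ p ∈ B, P p.1) : blockWord s B ∈ wordCone G s P :=
  AddSubmonoid.subset_closure ⟨1, B, zero_le_one, hB, hP, by simp⟩

/-- To map one cone into another by a linear map it is enough to map the words. -/
theorem map_mem_wordCone {P Q : V → Prop} (φ : A →ₗ[ℂ] A)
    (hφ : ∀ B, ReducedBlocks G B → (∀ p ∈ B, P p.1) → ∀ r : ℝ, 0 ≤ r →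
      (r : ℂ) • φ (blockWord s B) ∈ wordCone G s Q)
    {z : A} (hz : z ∈ wordCone G s P) : φ z ∈ wordCone G s Q := by
  induction hz using AddSubmonoid.closure_induction with
  | mem x hx =>
    obtain ⟨r, B, hr, hB, hP, rfl⟩ := hx
    rw [map_smul]
    exact hφ B hB hP r hr
  | zero => rw [map_zero]; exact zero_mem _
  | add x y _ _ hx hy => rw [map_add]; exact add_mem hx hy

theorem smul_mem_wordCone {P : V → Prop} {t : ℝ} (ht : 0 ≤ t) {z : A}
    (hz : z ∈ wordCone G s P) : (t : ℂ) • z ∈ wordCone G s P := by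
  refine map_mem_wordCone ((t : ℂ) • LinearMap.id) (fun B hB hP r hr => ?_) hz
  refine AddSubmonoid.subset_closure ⟨r * t, B, mul_nonneg hr ht, hB, hP, ?_⟩
  rw [LinearMap.smul_apply, LinearMap.id_apply, smul_smul, Complex.ofReal_mul]

theorem mul_mem_wordCone (hs : ∀ i j, G.Adj i j → Commute (s i) (s j)) {P : V → Prop} {i : V}
    (hi : P i) {z : A} (hz : z ∈ wordCone G s P) : s i * z ∈ wordCone G s P := by
  refine map_mem_wordCone (LinearMap.mulLeft ℂ (s i)) (fun B hB hP r hr => ?_) hz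
  refine smul_mem_wordCone hr ?_
  rw [LinearMap.mulLeft_apply, mul_blockWord hs]
  refine add_mem (blockWord_mem_wordCone (reducedBlocks_push i hB) (forall_mem_push hi hP)) ?_
  rcases hp : pop G i B with _ | B'
  · exact zero_mem _
  · exact blockWord_mem_wordCone (reducedBlocks_pop hB hp) (forall_mem_pop hP hp)

theorem pushSum_mem_wordCone {P : V → Prop} {c : Finset V} (hc : ∀ i ∈ c, P i) (n : ℕ)
    {B : List (V × ℕ)} (hB : ReducedBlocks G B) (hP : ∀ p ∈ B, P p.1) :
    pushSum G s c n B ∈ wordCone G s P := by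
  induction n generalizing B with
  | zero => exact blockWord_mem_wordCone hB hP
  | succ n ih =>
    exact sum_mem fun i hi => ih (reducedBlocks_push i hB) (forall_mem_push (hc i hi) hP)

theorem sum_mul_blockWord (hs : ∀ i j, G.Adj i j → Commute (s i) (s j)) {c : Finset V}
    {B : List (V × ℕ)} (hB : ∀ p ∈ B, p.1 ∉ c) :
    (∑ i ∈ c, s i) * blockWord s B = pushSum G s c 1 B := by
  rw [Finset.sum_mul]
  refine Finset.sum_congr rfl fun i hi => ?_
  rw [mul_blockWord hs, pop_eq_none_of_forall_ne fun p hp e => hB p hp (e ▸ hi)]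
  simp [pushSum]

/-- As `c` has no edges, the letter pushed last can be cancelled by itself only, once for each of
its `c.card` values. -/
theorem sum_mul_pushSum_succ (hs : ∀ i j, G.Adj i j → Commute (s i) (s j)) {c : Finset V}
    (hc : ∀ i ∈ c, ∀ j ∈ c, ¬ G.Adj i j) (n : ℕ) (B : List (V × ℕ)) :
    (∑ i ∈ c, s i) * pushSum G s c (n + 1) B =
      pushSum G s c (n + 2) B + (c.card : ℂ) • pushSum G s c n B := by
  classical
  induction n generalizing B with
  | zero =>
    have h : ∀ j ∈ c, (∑ i ∈ c, s i) * blockWord s (push G j B) =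
        ∑ i ∈ c, blockWord s (push G i (push G j B)) + blockWord s B := by
      intro j hj
      rw [Finset.sum_mul, Finset.sum_congr rfl fun i _ => mul_blockWord hs i _,
        Finset.sum_add_distrib, Finset.sum_eq_single_of_mem
          (f := fun i => (pop G i (push G j B)).elim 0 (blockWord s)) j hj
          fun i hi hij => by rw [pop_push_of_not_adj hij (hc i hi j hj)]; rfl,
        pop_push_self]
      rfl
    simp only [pushSum]
    rw [Finset.mul_sum, Finset.sum_congr rfl h, Finset.sum_add_distrib, Finset.sum_const,
      Nat.cast_smul_eq_nsmul]
  | succ n ih =>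
    rw [pushSum, Finset.mul_sum, Finset.sum_congr rfl fun i _ => ih (push G i B),
      Finset.sum_add_distrib, ← Finset.smul_sum]
    rfl

/-- Under `r ^ 2 * c.card = 1` the recursion of `sum_mul_pushSum_succ` is the Chebyshev recursion.
In particular the coefficients are nonnegative. -/
theorem aeval_S_mul_blockWord (hs : ∀ i j, G.Adj i j → Commute (s i) (s j)) {c : Finset V}
    (hc : ∀ i ∈ c, ∀ j ∈ c, ¬ G.Adj i j) {r : ℝ} (hr : r ^ 2 * c.card = 1)
    {B : List (V × ℕ)} (hB : ∀ p ∈ B, p.1 ∉ c) (n : ℕ) :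
    aeval ((r : ℂ) • ∑ i ∈ c, s i) (Chebyshev.S ℂ (n : ℤ)) * blockWord s B =
      ((r ^ n : ℝ) : ℂ) • pushSum G s c n B := by
  induction n using Nat.twoStepInduction with
  | zero => simp [pushSum]
  | one => simp [sum_mul_blockWord hs hB]
  | more n h0 h1 =>
    rw [aeval_S_add_two, sub_mul, mul_assoc, h0, h1, smul_mul_smul_comm,
      sum_mul_pushSum_succ hs hc, smul_add, smul_smul]
    have e1 : (r : ℂ) * ((r ^ (n + 1) : ℝ) : ℂ) = ((r ^ (n + 2) : ℝ) : ℂ) := by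
      push_cast; ring
    have e2 : ((r ^ (n + 2) : ℝ) : ℂ) * (c.card : ℂ) = ((r ^ n : ℝ) : ℂ) := by
      have : r ^ (n + 2) * c.card = r ^ n := by rw [pow_add, mul_assoc, hr, mul_one]
      exact_mod_cast this
    rw [e1, e2, add_sub_cancel_right]

theorem aeval_S_mul_mem_wordCone (hs : ∀ i j, G.Adj i j → Commute (s i) (s j)) {c : Finset V}
    (hc : ∀ i ∈ c, ∀ j ∈ c, ¬ G.Adj i j) {r : ℝ} (hr0 : 0 ≤ r) (hr : r ^ 2 * c.card = 1)
    {P Q : V → Prop} (hPc : ∀ i, P i → i ∉ c) (hPQ : ∀ i, P i → Q i) (hcQ : ∀ i ∈ c, Q i)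
    (n : ℕ) {z : A} (hz : z ∈ wordCone G s P) :
    aeval ((r : ℂ) • ∑ i ∈ c, s i) (Chebyshev.S ℂ (n : ℤ)) * z ∈ wordCone G s Q := by
  refine map_mem_wordCone (LinearMap.mulLeft ℂ _) (fun B hB hP t ht => ?_) hz
  rw [LinearMap.mulLeft_apply, aeval_S_mul_blockWord hs hc hr fun p hp => hPc _ (hP p hp)]
  exact smul_mem_wordCone ht (smul_mem_wordCone (pow_nonneg hr0 n)
    (pushSum_mem_wordCone hcQ n hB fun p hp => hPQ _ (hP p hp)))

end Cone

/-- An approximate eigenvector of multiplication by `X`, in the basis of Chebyshev polynomials. -/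
noncomputable def sineSum (θ : ℝ) (N : ℕ) : ℂ[X] :=
  ∑ l ∈ Finset.range N, ((Real.sin ((l + 1) * θ) : ℝ) : ℂ) • Chebyshev.S ℂ (l : ℤ)

/-- The sines form an eigenvector of the infinite path, with eigenvalue `2 cos θ`; only boundary
terms survive truncation, and the negative one vanishes when `(N + 1) θ = π`. -/
theorem X_sub_C_mul_sineSum (θ : ℝ) (N : ℕ) :
    (X - C ((2 * Real.cos θ : ℝ) : ℂ)) * sineSum θ N =
      ((Real.sin (N * θ) : ℝ) : ℂ) • Chebyshev.S ℂ (N : ℤ) -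
        ((Real.sin ((N + 1) * θ) : ℝ) : ℂ) • Chebyshev.S ℂ (N - 1 : ℤ) := by
  induction N with
  | zero => simp [sineSum]
  | succ N ih =>
    have h1 := Chebyshev.S_add_one ℂ (N : ℤ)
    have h2 : Real.sin (((N + 1 : ℕ) + 1) * θ) =
        2 * Real.cos θ * Real.sin ((N + 1) * θ) - Real.sin (N * θ) := by
      have e1 : ((N + 1 : ℕ) + 1 : ℝ) * θ = (N + 1) * θ + θ := by push_cast; ring
      have e2 : (N : ℝ) * θ = (N + 1) * θ - θ := by ring
      rw [e1, e2, Real.sin_add, Real.sin_sub]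
      ring
    rw [sineSum, Finset.sum_range_succ, ← sineSum, mul_add, ih, h2]
    push_cast
    rw [h1, add_sub_cancel_right]
    simp only [smul_eq_C_mul, map_sub, map_mul]
    ring

variable {V : Type*} {G : SimpleGraph V} {A : Type*} [CStarAlgebra A]
  {τ : A →ₗ[ℂ] ℂ} {s : V → A}

theorem IsGIndependentSemicircles.re_map_nonneg (h : IsGIndependentSemicircles G τ s)
    (hone : τ 1 = 1) {P : V → Prop} {z : A} (hz : z ∈ wordCone G s P) : 0 ≤ (τ z).re := by
  induction hz using AddSubmonoid.closure_induction with
  | mem x hx =>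
    obtain ⟨r, B, hr, hB, hP, rfl⟩ := hx
    rw [map_smul, smul_eq_mul, Complex.re_ofReal_mul]
    by_cases hne : B = []
    · simp [hne, blockWord, hone, hr]
    · simp [h.map_blockWord hB hne]
  | zero => simp
  | add x y _ _ hx hy => rw [map_add, Complex.add_re]; exact add_nonneg hx hy

/-- A Collatz–Wielandt argument: iterating gives `μ^n τ(z) ≤ τ(Y^n z) ≤ 2 ‖Y‖^n ‖z‖` in real parts,
and `n → ∞`. -/
theorem IsGIndependentSemicircles.le_norm_of_mul_sub_mem (h : IsGIndependentSemicircles G τ s)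
    (hτ : IsFaithfulState τ) {P : V → Prop} {Y z : A} {μ : ℝ} (hμ : 0 ≤ μ)
    (hY : ∀ w ∈ wordCone G s P, Y * w ∈ wordCone G s P)
    (hz : Y * z - (μ : ℂ) • z ∈ wordCone G s P) (hpos : 0 < (τ z).re) : μ ≤ ‖Y‖ := by
  have hYn : ∀ (n : ℕ), ∀ w ∈ wordCone G s P, Y ^ n * w ∈ wordCone G s P := by
    intro n
    induction n with
    | zero => simp
    | succ n ih =>
      intro w hw
      rw [pow_succ, mul_assoc]
      exact ih _ (hY w hw)
  have hlow : ∀ n : ℕ, μ ^ n * (τ z).re ≤ (τ (Y ^ n * z)).re := by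
    intro n
    induction n with
    | zero => simp
    | succ n ih =>
      have h1 := h.re_map_nonneg hτ.map_one (hYn n _ hz)
      rw [mul_sub, ← mul_assoc, ← pow_succ, mul_smul_comm, map_sub, map_smul, Complex.sub_re,
        smul_eq_mul, Complex.re_ofReal_mul] at h1
      rw [pow_succ']
      nlinarith
  have hup : ∀ n : ℕ, μ ^ n * (τ z).re ≤ ‖Y‖ ^ n * (2 * ‖z‖) := by
    intro n
    by_cases hn : n = 0
    · subst hn
      simpa using (Complex.re_le_norm _).trans (hτ.norm_apply_le z)
    · calc μ ^ n * (τ z).re ≤ ‖τ (Y ^ n * z)‖ := (hlow n).trans (Complex.re_le_norm _)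
        _ ≤ 2 * ‖Y ^ n * z‖ := hτ.norm_apply_le _
        _ ≤ 2 * (‖Y‖ ^ n * ‖z‖) := by
          gcongr
          exact (norm_mul_le _ _).trans (by gcongr; exact norm_pow_le' _ (Nat.pos_of_ne_zero hn))
        _ = _ := by ring
  by_contra! hlt
  have hμ0 : 0 < μ := (norm_nonneg Y).trans_lt hlt
  have hlim : Filter.Tendsto (fun n : ℕ => (‖Y‖ / μ) ^ n * (2 * ‖z‖)) Filter.atTop
      (nhds (0 * (2 * ‖z‖))) :=
    (tendsto_pow_atTop_nhds_zero_of_lt_one (by positivity) ((div_lt_one hμ0).2 hlt)).mul_const _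
  rw [zero_mul] at hlim
  refine absurd (ge_of_tendsto' (b := (τ z).re) hlim fun n => ?_) (not_le.2 hpos)
  rw [div_pow, div_mul_eq_mul_div, le_div_iff₀ (by positivity)]
  linarith [hup n]

/-- The normalized sum of the `s i` in the class `k` of the colouring `f`. -/
noncomputable def classSum [Fintype V] (f : V → ℕ) (r : ℝ) (s : V → A) (k : ℕ) : A :=
  (r : ℂ) • ∑ i ∈ Finset.univ.filter (fun i => f i = k), s i

/-- The product of the approximate eigenvectors of the first `k` classes. -/
noncomputable def classVector [Fintype V] (f : V → ℕ) (r : ℝ) (s : V → A) (θ : ℝ) (N : ℕ) :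
    ℕ → A
  | 0 => 1
  | k + 1 => aeval (classSum f r s k) (sineSum θ N) * classVector f r s θ N k

section Multipartite

variable [Fintype V] {f : V → ℕ} {ω N : ℕ} {r θ : ℝ}

theorem aeval_S_classSum_mul_mem (hs : ∀ i j, G.Adj i j → Commute (s i) (s j))
    (hG : ∀ i j, G.Adj i j ↔ f i ≠ f j) (hr0 : 0 ≤ r) {k : ℕ}
    (hr : r ^ 2 * (Finset.univ.filter fun i => f i = k).card = 1) (n : ℕ) {z : A}
    (hz : z ∈ wordCone G s fun i => f i < k) :
    aeval (classSum f r s k) (Chebyshev.S ℂ (n : ℤ)) * z ∈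
      wordCone G s fun i => f i < k + 1 := by
  refine aeval_S_mul_mem_wordCone hs ?_ hr0 hr ?_ ?_ ?_ n hz
  · intro i hi j hj
    simp only [Finset.mem_filter, Finset.mem_univ, true_and] at hi hj
    simp [hG, hi, hj]
  · intro i hi
    simp only [Finset.mem_filter, Finset.mem_univ, true_and]
    omega
  · intro i hi
    omega
  · intro i hi
    simp only [Finset.mem_filter, Finset.mem_univ, true_and] at hi
    omega

theorem aeval_sineSum_classSum_mul_mem (hs : ∀ i j, G.Adj i j → Commute (s i) (s j))
    (hG : ∀ i j, G.Adj i j ↔ f i ≠ f j) (hr0 : 0 ≤ r) {k : ℕ}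
    (hr : r ^ 2 * (Finset.univ.filter fun i => f i = k).card = 1)
    (hsin : ∀ l < N, 0 ≤ Real.sin ((l + 1) * θ)) {z : A}
    (hz : z ∈ wordCone G s fun i => f i < k) :
    aeval (classSum f r s k) (sineSum θ N) * z ∈ wordCone G s fun i => f i < k + 1 := by
  rw [sineSum, map_sum, Finset.sum_mul]
  refine sum_mem fun l hl => ?_
  rw [map_smul, smul_mul_assoc]
  exact smul_mem_wordCone (hsin l (Finset.mem_range.1 hl))
    (aeval_S_classSum_mul_mem hs hG hr0 hr l hz)

theorem classVector_mem (hs : ∀ i j, G.Adj i j → Commute (s i) (s j))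
    (hG : ∀ i j, G.Adj i j ↔ f i ≠ f j) (hr0 : 0 ≤ r)
    (hr : ∀ k < ω, r ^ 2 * (Finset.univ.filter fun i => f i = k).card = 1)
    (hsin : ∀ l < N, 0 ≤ Real.sin ((l + 1) * θ)) {k : ℕ} (hk : k ≤ ω) :
    classVector f r s θ N k ∈ wordCone G s fun i => f i < k := by
  induction k with
  | zero => exact blockWord_mem_wordCone (B := []) trivial (by simp)
  | succ k ih =>
    exact aeval_sineSum_classSum_mul_mem hs hG hr0 (hr k hk) hsin (ih (by omega))

theorem commute_classSum (hs : ∀ i j, G.Adj i j → Commute (s i) (s j))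
    (hG : ∀ i j, G.Adj i j ↔ f i ≠ f j) {k l : ℕ} (hkl : k ≠ l) :
    Commute (classSum f r s k) (classSum f r s l) := by
  refine ((Commute.sum_left _ _ _ fun i hi => Commute.sum_right _ _ _ fun j hj => ?_).smul_left
    _).smul_right _
  simp only [Finset.mem_filter, Finset.mem_univ, true_and] at hi hj
  exact hs i j ((hG i j).2 (by omega))

theorem sum_classSum_mul_classVector_sub_mem (hs : ∀ i j, G.Adj i j → Commute (s i) (s j))
    (hG : ∀ i j, G.Adj i j ↔ f i ≠ f j) (hr0 : 0 ≤ r)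
    (hr : ∀ k < ω, r ^ 2 * (Finset.univ.filter fun i => f i = k).card = 1)
    (hsin : ∀ l < N, 0 ≤ Real.sin ((l + 1) * θ)) (hN : 0 ≤ Real.sin (N * θ))
    (hN1 : Real.sin ((N + 1) * θ) = 0) {k : ℕ} (hk : k ≤ ω) :
    (∑ c ∈ Finset.range k, classSum f r s c) * classVector f r s θ N k -
      ((k * (2 * Real.cos θ) : ℝ) : ℂ) • classVector f r s θ N k ∈
        wordCone G s fun i => f i < k := by
  induction k with
  | zero => simp
  | succ k ih =>
    set y := classSum f r s k with hy
    set q := sineSum θ N with hq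
    set b := classVector f r s θ N k with hb
    set x := ∑ c ∈ Finset.range k, classSum f r s c with hx
    have hcomm : Commute x (aeval y q) := by
      refine (Algebra.commute_of_mem_adjoin_singleton_of_commute
        (aeval_mem_adjoin_singleton _ _) (Commute.sum_left _ _ _ fun c hc => ?_))
      exact commute_classSum hs hG (Finset.mem_range.1 hc).ne
    have h1 : y * aeval y q - ((2 * Real.cos θ : ℝ) : ℂ) • aeval y q =
        ((Real.sin (N * θ) : ℝ) : ℂ) • aeval y (Chebyshev.S ℂ (N : ℤ)) := by
      have := congrArg (aeval y) (X_sub_C_mul_sineSum θ N)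
      rw [hN1] at this
      simpa [sub_mul, ← hq, Algebra.smul_def] using this
    -- By commutation the defect splits into the defect of the earlier classes times `q(y)`, plus
    -- the boundary term of the new class; both lie in the cone.
    have h2 : (∑ c ∈ Finset.range (k + 1), classSum f r s c) * classVector f r s θ N (k + 1) -
        (((k + 1 : ℕ) * (2 * Real.cos θ) : ℝ) : ℂ) • classVector f r s θ N (k + 1) =
        aeval y q * (x * b - ((k * (2 * Real.cos θ) : ℝ) : ℂ) • b) +
          ((Real.sin (N * θ) : ℝ) : ℂ) • (aeval y (Chebyshev.S ℂ (N : ℤ)) * b) := by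
      rw [Finset.sum_range_succ, ← hx, ← hy, classVector, ← hy, ← hq, ← hb, add_mul,
        ← mul_assoc x, hcomm.eq, ← smul_mul_assoc ((Real.sin (N * θ) : ℝ) : ℂ), ← h1, mul_sub,
        sub_mul, ← mul_assoc y, mul_assoc (aeval y q) x, mul_smul_comm, smul_mul_assoc]
      have h3 : (((k + 1 : ℕ) * (2 * Real.cos θ) : ℝ) : ℂ) =
          ((k * (2 * Real.cos θ) : ℝ) : ℂ) + ((2 * Real.cos θ : ℝ) : ℂ) := by
        push_cast; ring
      rw [h3, add_smul]
      abel
    rw [h2]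
    exact add_mem
      (aeval_sineSum_classSum_mul_mem hs hG hr0 (hr k hk) hsin (ih (by omega)))
      (smul_mem_wordCone hN (aeval_S_classSum_mul_mem hs hG hr0 (hr k hk) N
        (classVector_mem hs hG hr0 hr hsin (by omega))))

/-- Each class contributes its constant term `sin θ • S_0`; all other terms have nonnegative trace.
-/
theorem IsGIndependentSemicircles.sin_pow_le_re_map_classVector
    (h : IsGIndependentSemicircles G τ s) (hone : τ 1 = 1)
    (hG : ∀ i j, G.Adj i j ↔ f i ≠ f j) (hr0 : 0 ≤ r)
    (hr : ∀ k < ω, r ^ 2 * (Finset.univ.filter fun i => f i = k).card = 1)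
    (hN : 0 < N) (hsin : ∀ l < N, 0 ≤ Real.sin ((l + 1) * θ)) {k : ℕ} (hk : k ≤ ω) :
    Real.sin θ ^ k ≤ (τ (classVector f r s θ N k)).re := by
  have hs : ∀ i j, G.Adj i j → Commute (s i) (s j) := fun _ _ => h.commute
  have hsin0 : 0 ≤ Real.sin θ := by simpa using hsin 0 hN
  induction k with
  | zero => simp [classVector, hone]
  | succ k ih =>
    obtain ⟨N, rfl⟩ : ∃ M, N = M + 1 := ⟨N - 1, by omega⟩
    have hmem := classVector_mem hs hG hr0 hr hsin (k := k) (by omega)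
    rw [classVector, sineSum, Finset.sum_range_succ', map_add, add_mul, map_add, Complex.add_re,
      map_sum, Finset.sum_mul]
    have h1 : 0 ≤ (τ (∑ l ∈ Finset.range N, aeval (classSum f r s k)
        (((Real.sin (((l + 1 : ℕ) + 1) * θ) : ℝ) : ℂ) • Chebyshev.S ℂ ((l + 1 : ℕ) : ℤ)) *
          classVector f r s θ (N + 1) k)).re := by
      refine h.re_map_nonneg hone (P := fun i => f i < k + 1) (sum_mem fun l hl => ?_)
      rw [map_smul, smul_mul_assoc]
      refine smul_mem_wordCone (hsin (l + 1) ?_) (aeval_S_classSum_mul_mem hs hG hr0 (hr k hk) _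
        hmem)
      have := Finset.mem_range.1 hl
      omega
    refine le_add_of_nonneg_of_le h1 ?_
    simp only [Nat.cast_zero, zero_add, one_mul, Chebyshev.S_zero, map_smul, map_one,
      smul_mul_assoc, smul_eq_mul, Complex.re_ofReal_mul]
    rw [pow_succ']
    exact mul_le_mul_of_nonneg_left (ih (by omega)) hsin0

theorem IsGIndependentSemicircles.two_mul_le_norm_smul_sum
    (h : IsGIndependentSemicircles G τ s) (hτ : IsFaithfulState τ)
    (hG : ∀ i j, G.Adj i j ↔ f i ≠ f j) (hf : ∀ i, f i < ω) (hr0 : 0 ≤ r)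
    (hr : ∀ k < ω, r ^ 2 * (Finset.univ.filter fun i => f i = k).card = 1) :
    2 * (ω : ℝ) ≤ ‖(r : ℂ) • ∑ i, s i‖ := by
  have hs : ∀ i j, G.Adj i j → Commute (s i) (s j) := fun _ _ => h.commute
  have hY : ∑ c ∈ Finset.range ω, classSum f r s c = (r : ℂ) • ∑ i, s i := by
    simp only [classSum]
    rw [← Finset.smul_sum, Finset.sum_fiberwise_of_maps_to fun i _ => Finset.mem_range.2 (hf i)]
  have key : ∀ n : ℕ, ω * (2 * Real.cos (Real.pi / (n + 2))) ≤ ‖(r : ℂ) • ∑ i, s i‖ := by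
    intro n
    -- With `N = n + 1` this gives `(N + 1) θ = π`: all sine weights are nonnegative and the
    -- negative boundary term is zero.
    set θ := Real.pi / (n + 2) with hθ
    have hθ0 : 0 < θ := by have := Real.pi_pos; positivity
    have hNθ : (((n + 1 : ℕ) : ℝ) + 1) * θ = Real.pi := by
      rw [hθ]; push_cast; field_simp; ring
    have hθ2 : θ ≤ Real.pi / 2 := by
      rw [hθ]
      have := Real.pi_pos
      gcongr
      linarith [(Nat.cast_nonneg n : (0 : ℝ) ≤ n)]
    have hle : ∀ l : ℕ, l ≤ n + 1 → 0 ≤ Real.sin (l * θ) := by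
      intro l hl
      refine Real.sin_nonneg_of_nonneg_of_le_pi (by positivity) (hNθ ▸ ?_)
      gcongr
      exact (Nat.cast_le.2 hl).trans (by linarith)
    have hsin : ∀ l < n + 1, 0 ≤ Real.sin ((l + 1) * θ) := fun l hl => by
      simpa using hle (l + 1) hl
    refine h.le_norm_of_mul_sub_mem hτ (P := fun i => f i < ω)
      (z := classVector f r s θ (n + 1) ω) ?_ ?_ ?_ ?_
    · have := Real.cos_nonneg_of_neg_pi_div_two_le_of_le (by linarith) hθ2
      positivity
    · intro w hw
      rw [smul_mul_assoc, Finset.sum_mul]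
      exact smul_mem_wordCone hr0 (sum_mem fun i _ => mul_mem_wordCone hs (hf i) hw)
    · rw [← hY]
      exact sum_classSum_mul_classVector_sub_mem hs hG hr0 hr hsin (hle _ le_rfl)
        (by rw [hNθ, Real.sin_pi]) le_rfl
    · refine lt_of_lt_of_le ?_
        (h.sin_pow_le_re_map_classVector hτ.map_one hG hr0 hr (Nat.succ_pos n) hsin le_rfl)
      exact pow_pos (Real.sin_pos_of_pos_of_lt_pi hθ0 (by linarith [Real.pi_pos])) _
  have hlim : Filter.Tendsto (fun n : ℕ => (ω : ℝ) * (2 * Real.cos (Real.pi / (n + 2))))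
      Filter.atTop (nhds (ω * (2 * Real.cos 0))) := by
    refine ((Real.continuous_cos.tendsto 0).comp ?_).const_mul 2 |>.const_mul _
    refine tendsto_const_nhds.div_atTop ?_
    exact Filter.tendsto_atTop_add_const_right _ _ tendsto_natCast_atTop_atTop
  rw [Real.cos_zero, mul_one, mul_comm] at hlim
  exact le_of_tendsto' hlim key

end Multipartite

end LowerBound

end GraphIndependence

/-! ### Normalization and the Turán graph. -/

namespace GraphIndependence

theorem norm_normalizedSum {A : Type*} [CStarAlgebra A] {L : ℕ} (s : Fin L → A) :
    ‖normalizedSum s‖ = (√(L : ℝ))⁻¹ * ‖∑ i, s i‖ := by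
  rw [normalizedSum, norm_smul, Complex.norm_real, Real.norm_of_nonneg (by positivity)]

theorem IsGIndependentSemicircles.norm_normalizedSum_le {L : ℕ} {G : SimpleGraph (Fin L)}
    {A : Type*} [CStarAlgebra A] {τ : A →ₗ[ℂ] ℂ} {s : Fin L → A}
    (h : IsGIndependentSemicircles G τ s) (hτ : IsFaithfulState τ) (hL : 0 < L) {ω : ℕ}
    (hω : 0 < ω) (hclique : ∀ t : Finset (Fin L), G.IsClique t → t.card ≤ ω) :
    ‖normalizedSum s‖ ≤ 2 * √(ω : ℝ) := by
  have hL' : 0 < √(L : ℝ) := Real.sqrt_pos.2 (Nat.cast_pos.2 hL)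
  have hω' : 0 < √(ω : ℝ) := Real.sqrt_pos.2 (Nat.cast_pos.2 hω)
  have := h.norm_sum_le hτ hL' hω' (by simp) (fun t ht => by
    rw [Real.sq_sqrt (Nat.cast_nonneg _)]
    exact_mod_cast hclique t ht)
  rw [norm_normalizedSum, inv_mul_le_iff₀ hL']
  linarith

theorem card_filter_mod_eq {L ω : ℕ} (hω : ω ∣ L) {k : ℕ} (hk : k < ω) :
    (Finset.univ.filter fun i : Fin L => (i : ℕ) % ω = k).card = L / ω := by
  rw [Finset.card_filter, Fin.sum_univ_eq_sum_range (fun i => if i % ω = k then 1 else 0) L,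
    ← Finset.card_filter, ← Nat.count_eq_card_filter_range]
  have := Nat.count_modEq_card L (by omega : 0 < ω) k
  rw [Nat.mod_eq_zero_of_dvd hω] at this
  simpa [Nat.ModEq, Nat.mod_eq_of_lt hk] using this

theorem IsGIndependentSemicircles.le_norm_normalizedSum_turanGraph {L ω : ℕ} (hL : 0 < L)
    (hω : ω ∣ L) {A : Type*} [CStarAlgebra A] {τ : A →ₗ[ℂ] ℂ} {s : Fin L → A}
    (h : IsGIndependentSemicircles (SimpleGraph.turanGraph L ω) τ s) (hτ : IsFaithfulState τ) :
    2 * √(ω : ℝ) ≤ ‖normalizedSum s‖ := by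
  obtain ⟨m, rfl⟩ := hω
  have hω0 : 0 < ω := Nat.pos_of_mul_pos_right hL
  have hm0 : 0 < m := Nat.pos_of_mul_pos_left hL
  have hmR : (0 : ℝ) < m := Nat.cast_pos.2 hm0
  have hωR : (0 : ℝ) < ω := Nat.cast_pos.2 hω0
  have hr : ∀ k < ω, ((√(m : ℝ))⁻¹) ^ 2 *
      (Finset.univ.filter fun i : Fin (ω * m) => (i : ℕ) % ω = k).card = (1 : ℝ) := by
    intro k hk
    rw [card_filter_mod_eq (dvd_mul_right ω m) hk, Nat.mul_div_cancel_left _ hω0, inv_pow,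
      Real.sq_sqrt hmR.le, inv_mul_cancel₀ hmR.ne']
  -- Classes are residues mod `ω`, of size `m`, hence `r = m^{-1/2}`; the normalized sum is this one
  -- divided by `√ω`.
  have key := h.two_mul_le_norm_smul_sum hτ (f := fun i : Fin (ω * m) => (i : ℕ) % ω) (r := (√(m : ℝ))⁻¹) (fun i j => Iff.rfl)
    (fun i => Nat.mod_lt _ hω0) (by positivity) hr
  rw [norm_smul, Complex.norm_real, Real.norm_of_nonneg (by positivity)] at key
  have hsq : √(ω : ℝ) * √(ω : ℝ) = ω := Real.mul_self_sqrt hωR.le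
  have hωs : 0 < √(ω : ℝ) := Real.sqrt_pos.2 hωR
  rw [norm_normalizedSum, Nat.cast_mul, Real.sqrt_mul hωR.le, mul_inv, mul_assoc,
    le_inv_mul_iff₀ hωs]
  linarith

end GraphIndependence

theorem corollary1p2 (L ω : ℕ) (hL : 0 < L) (hω : ω ∣ L)
    -- the `K`-independent semicircles, `K` being the Turán graph with `ω` classes of size `L / ω`
    {B : Type*} [CStarAlgebra B] (σ : B →ₗ[ℂ] ℂ) (hσ : GraphIndependence.IsFaithfulState σ)
    (t : Fin L → B)
    (ht : GraphIndependence.IsGIndependentSemicircles (SimpleGraph.turanGraph L ω) σ t) :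
    (∀ (G : SimpleGraph (Fin L)), G.cliqueNum = ω →
      ∀ {A : Type*} [CStarAlgebra A] (τ : A →ₗ[ℂ] ℂ), GraphIndependence.IsFaithfulState τ →
      ∀ s : Fin L → A, GraphIndependence.IsGIndependentSemicircles G τ s →
        ‖GraphIndependence.normalizedSum s‖ ≤ ‖GraphIndependence.normalizedSum t‖) ∧
    ‖GraphIndependence.normalizedSum t‖ = 2 * √(ω : ℝ) := by
  have hω0 : 0 < ω := Nat.pos_of_dvd_of_pos hω hL
  have hlow := ht.le_norm_normalizedSum_turanGraph hL hω hσ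
  refine ⟨fun G hG A _ τ hτ s hs => ?_, le_antisymm ?_ hlow⟩
  · refine (hs.norm_normalizedSum_le hτ hL hω0 fun c hc => ?_).trans hlow
    exact hG ▸ hc.card_le_cliqueNum
  · refine ht.norm_normalizedSum_le hσ hL hω0 fun c hc => ?_
    by_contra! hlt
    exact (SimpleGraph.turanGraph_cliqueFree hω0).mono hlt c ⟨hc, rfl⟩
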